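/- For a sequence $\mathcal A=(a(n))_{n\ge 1}$ of non-negative real numbers write $\mathcal A(t)=\sum_{n\le t}a(n)$ and $\mathcal A(t;q,b)=\sum_{n\le t,\ n\equiv b\,(\mathrm{mod}\ q)}a(n)$. Let $h$ be a multiplicative function with $0\le h(n)\le 1$ for all $n$. For an integer $q\ge 1$ put $$\gamma_q=\prod_{p\mid q}\frac{p-1}{p-h(p)},$$ and let $f_q$ be the multiplicative function, extended to all integers by $f_q(b)=f_q(\gcd(b,q))$, with $f_q(p^k)=1$ if $p\nmid q$ and, if $p^e$ ($e\ge1$) is the exact power of the prime $p$ dividing $q$, $$f_q(p^k)=\begin{cases}\bigl(h(p^k)-h(p^{k+1})/p\bigr)\bigl(1-h(p)/p\bigr)^{-1}, & k<e,\\ h(p^e)\bigl(1-1/p\bigr)\bigl(1-h(p)/p\bigr)^{-1}, & k\ge e.\end{cases}$$ **Corollary 1.4.** There are absolute constants $c>0$ and $x_0$ such that the following holds for every real $x\ge x_0$, every sequence $\mathcal A$ and every $h$ as above, and every finite set $\mathcal S$ of primes with $\mathcal S\subset[1,\log\log x]$. Suppose that $$\sum_{p\le \log x}\frac{1-h(p)}{p}\log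 p\ \ge\ \alpha\log\log x$$ for some $\alpha\ge 60\log\log\log x/\log\log x$, and set $\eta=\min(\alpha/3,1/100)$. Then for each $u$ with $5/\eta^2\le u\le \eta(\log x)^{\eta/2}$ at least one of the following two assertions holds. (i) There is an interval $(v,v+y)\subset(x/4,x)$ ($v,y$ real) with $y\ge(\log x)^u$ such that $$\Bigl|\mathcal A(v+y)-\mathcal A(v)-y\frac{\mathcal A(x)}{x}\Bigr|\ \ge\ c\,\exp\Bigl(-\frac u\eta(1+25\eta)\log(2u/\eta^3)\Bigr)\,y\,\frac{\mathcal A(x)}{x}.$$ (ii) There are $y\in(x/4,x)$ and an arithmetic progression $b\pmod q$, where $q\le\exp(2(\log x)^{1-\eta})$ is a positive integer coprime to every prime in $\mathcal S$, such that $$\Bigl|\mathcal A(y;q,b)-\frac{f_q(b)}{q\gamma_q}\,y\,\frac{\mathcal A(x)}{x}\Bigr|\ \ge\ c\,\exp\Bigl(-\frac u\eta(1+25\eta)\log(2u/\eta^3)\Bigr)\frac{\mathcal A(x)}{\phi(q)}.$$ -/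

import Mathlib

noncomputable section

namespace ArithSeq

/-- Summatory function `A(x) = ∑_{1 ≤ n ≤ x} a(n)` of a real sequence. -/
def sum (a : ℕ → ℝ) (x : ℝ) : ℝ :=
  ∑ n ∈ Finset.Icc 1 ⌊x⌋₊, a n

/-- `A(x; q, b) = ∑ a(n)` over `1 ≤ n ≤ x` with `n ≡ b (mod q)`. -/
def sumAP (a : ℕ → ℝ) (x : ℝ) (q b : ℕ) : ℝ :=
  ∑ n ∈ Finset.Icc 1 ⌊x⌋₊ with n ≡ b [MOD q], a n

/-- `(q, S) = 1`: the integer `q` is coprime to every element of `S`. -/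
def CoprimeTo (q : ℕ) (S : Finset ℕ) : Prop :=
  ∀ p ∈ S, Nat.Coprime q p

/-- `γ_q = ∏_{p ∣ q} ((p - 1) / (p - h(p)))`. -/
def gam (h : ArithmeticFunction ℝ) (q : ℕ) : ℝ :=
  ∏ p ∈ q.primeFactors, ((p : ℝ) - 1) / ((p : ℝ) - h p)

/-- The value `f_q(p ^ k)` at a prime power, where `p ^ e` is the exact power of `p` dividing `q`
(so `e = q.factorization p`). -/
def fPrimePow (h : ArithmeticFunction ℝ) (q p k : ℕ) : ℝ :=
  if ¬ p ∣ q then 1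
  else if k < q.factorization p then
    (h (p ^ k) - h (p ^ (k + 1)) / p) * (1 - h p / p)⁻¹
  else
    h (p ^ q.factorization p) * (1 - 1 / (p : ℝ)) * (1 - h p / p)⁻¹

/-- The multiplicative function `f_q`, with `f_q(b) = f_q((b, q))`: the product of the values
`f_q(p ^ k)` over the prime powers `p ^ k` exactly dividing `(b, q)`. -/
def f (h : ArithmeticFunction ℝ) (q b : ℕ) : ℝ :=
  (Nat.gcd b q).factorization.prod fun p k => fPrimePow h q p k

end ArithSeq

end

/-! Write L = log x and suppose both assertions fail. For a squarefree q built from primes in (L^η,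
L^(1-η)], put the a(n) in a Maier matrix whose rows are intervals of length Y ≈ L^u and whose
columns are progressions mod q. Summing it by rows and by columns forces ∑_{n≤Y} f_q(n) to lie
within a tiny multiple of Y of γ_q Y, for every such q at once (`ArithSeq.abs_sum_sub_le_of_maier`).

That is impossible (`exists_subset_lt_abs_sum_f_sub`). By Mertens the primes in this range carry
total weight ∑ (1-h(p))/p ≫ η, so they contain k ≈ u/η disjoint blocks of weight ≫ η/k each; let q_j
be the product of block j. An n ≤ Y ≤ L^(ηk) is too small to have a prime factor in every block, so
some f_{q_j}(n) = 1 and ∏(1 - f_{q_j}(n)) = 0. Expand over sets of blocks and sum over n: if every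
mean were close to its γ, then ∏(1 - γ_{q_j}) would be nearly 0, yet each factor is ≫ η/k. Hence for
one of the 2^k products the discrepancy is at least (η/(10k))^k Y. This beats the exponential in the
theorem, even after the matrix loses a factor of order q/φ(q) ≤ exp(4/η). -/

/-! ### Mertens' first theorem -/

/-- The sum `∑_{p ≤ t} log p / p` over primes. -/
noncomputable def primeLogSum (t : ℝ) : ℝ :=
  ∑ p ∈ Finset.Icc 1 ⌊t⌋₊ with p.Prime, Real.log p / (p : ℝ)

theorem log_factorial_eq_sum_padicValNat (N : ℕ) :
    Real.log (N.factorial : ℝ) =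
      ∑ p ∈ Finset.Icc 1 N with p.Prime, (padicValNat p N.factorial : ℝ) * Real.log p := by
  have h0 := Nat.factorial_ne_zero N
  have hsub : N.factorial.primeFactors ⊆ (Finset.Icc 1 N).filter Nat.Prime := by
    intro p hp
    have hp' := Nat.prime_of_mem_primeFactors hp
    have := (hp'.dvd_factorial).1 (Nat.dvd_of_mem_primeFactors hp)
    simp [hp', this, hp'.one_lt.le]
  conv_lhs => rw [← Nat.prod_factorization_pow_eq_self h0]
  rw [Finsupp.prod, Nat.support_factorization, Nat.cast_prod, Real.log_prod]
  · rw [← Finset.sum_subset hsub]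
    · refine Finset.sum_congr rfl fun p hp => ?_
      rw [Nat.cast_pow, Real.log_pow, Nat.factorization_def _ (Nat.prime_of_mem_primeFactors hp)]
    · intro p hp hp'
      have hpp : p.Prime := (Finset.mem_filter.1 hp).2
      rw [← Nat.factorization_def _ hpp]
      rw [← Nat.support_factorization, Finsupp.notMem_support_iff] at hp'
      simp [hp']
  · intro p hp
    have := (Nat.prime_of_mem_primeFactors hp).pos
    positivity

theorem div_le_padicValNat_factorial {p : ℕ} (hp : p.Prime) (N : ℕ) :
    N / p ≤ padicValNat p N.factorial := by
  have := Fact.mk hp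
  rw [padicValNat_factorial (b := Nat.log p N + 2) (by omega)]
  calc N / p = N / p ^ 1 := by simp
    _ ≤ _ := Finset.single_le_sum (f := fun i => N / p ^ i) (fun _ _ => Nat.zero_le _) (by simp)

theorem log_factorial_le (N : ℕ) : Real.log (N.factorial : ℝ) ≤ N * Real.log N := by
  rw [← Real.log_pow]
  exact Real.log_le_log (by exact_mod_cast Nat.factorial_pos N)
    (by exact_mod_cast Nat.factorial_le_pow N)

theorem le_log_factorial (N : ℕ) : N * Real.log N - N ≤ Real.log (N.factorial : ℝ) := by
  rcases Nat.eq_zero_or_pos N with rfl | hN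
  · simp
  have hN' : (0 : ℝ) < N := by exact_mod_cast hN
  have h1 := Real.pow_div_factorial_le_exp (N : ℝ) hN'.le N
  have hf : (0 : ℝ) < N.factorial := by exact_mod_cast Nat.factorial_pos N
  have h2 := Real.log_le_log (by positivity) h1
  rw [Real.log_exp, Real.log_div (by positivity) hf.ne', Real.log_pow] at h2
  linarith

/-- Legendre gives N/p ≤ v_p(N!) + 1. The rounding term costs θ(N) ≤ N log 4, and log N! ≤ N log N.
-/
theorem primeLogSum_le {t : ℝ} (ht : 1 ≤ t) : primeLogSum t ≤ Real.log t + Real.log 4 := by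
  set N := ⌊t⌋₊ with hN
  have hN1 : 1 ≤ N := Nat.one_le_floor_iff _ |>.2 ht
  have hNR : (0 : ℝ) < N := by exact_mod_cast hN1
  have hNt : (N : ℝ) ≤ t := Nat.floor_le (by linarith)
  have hth : Chebyshev.theta N ≤ Real.log 4 * N := Chebyshev.theta_le_log4_mul_x hNR.le
  rw [Chebyshev.theta_eq_sum_Icc, Nat.floor_natCast] at hth
  have hth' : ∑ p ∈ Finset.Icc 1 N with p.Prime, Real.log p ≤ Real.log 4 * N := by
    refine le_trans (Finset.sum_le_sum_of_subset_of_nonneg ?_ ?_) hth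
    · intro p hp
      simp only [Finset.mem_filter, Finset.mem_Icc] at hp ⊢
      exact ⟨⟨by omega, hp.1.2⟩, hp.2⟩
    · intro p _ _
      exact Real.log_natCast_nonneg p
  have key : N * primeLogSum t ≤ N * Real.log N + Real.log 4 * N := by
    refine le_trans ?_ (add_le_add (log_factorial_le N) hth')
    rw [log_factorial_eq_sum_padicValNat, primeLogSum, Finset.mul_sum, ← Finset.sum_add_distrib]
    refine Finset.sum_le_sum fun p hp => ?_
    have hpp : p.Prime := (Finset.mem_filter.1 hp).2
    have hp0 : (0 : ℝ) < p := by exact_mod_cast hpp.pos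
    have h1 : (N : ℝ) / p ≤ padicValNat p N.factorial + 1 := by
      have h2 : ((N / p : ℕ) : ℝ) ≤ padicValNat p N.factorial := by
        exact_mod_cast div_le_padicValNat_factorial hpp N
      have h3 : (N : ℝ) / p < (N / p : ℕ) + 1 := by
        rw [div_lt_iff₀ hp0]
        rw [mul_comm]; exact_mod_cast Nat.lt_mul_div_succ N hpp.pos
      linarith
    have hlog : 0 ≤ Real.log p := Real.log_natCast_nonneg p
    calc (N : ℝ) * (Real.log p / p) = (N : ℝ) / p * Real.log p := by ring
      _ ≤ (padicValNat p N.factorial + 1) * Real.log p := by gcongr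
      _ = _ := by ring
  have h4 : primeLogSum t ≤ Real.log N + Real.log 4 := by
    by_contra! hc
    nlinarith
  have := Real.log_le_log hNR hNt
  linarith

/-- Here v_p(N!) ≤ N/(p-1) is compared with log N! ≥ N log N - N. Replacing 1/(p-1) by 1/p costs
O(p^(-3/2)) per prime, which is summable. -/
theorem exists_le_primeLogSum : ∃ C : ℝ, ∀ t : ℝ, 1 ≤ t → Real.log t - C ≤ primeLogSum t := by
  have hs : Summable fun n : ℕ => 4 * (1 / (n : ℝ) ^ (3 / 2 : ℝ)) :=
    (Real.summable_one_div_nat_rpow.2 (by norm_num)).mul_left 4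
  refine ⟨1 + (∑' n : ℕ, 4 * (1 / (n : ℝ) ^ (3 / 2 : ℝ))) + 1, fun t ht => ?_⟩
  set N := ⌊t⌋₊ with hN
  have hN1 : 1 ≤ N := Nat.one_le_floor_iff _ |>.2 ht
  have hNR : (1 : ℝ) ≤ N := by exact_mod_cast hN1
  have hNt : t < N + 1 := Nat.lt_floor_add_one t
  have key : Real.log (N.factorial : ℝ) ≤
      N * (primeLogSum t + ∑' n : ℕ, 4 * (1 / (n : ℝ) ^ (3 / 2 : ℝ))) := by
    have hle : ∑ p ∈ Finset.Icc 1 N with p.Prime, 4 * (1 / (p : ℝ) ^ (3 / 2 : ℝ)) ≤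
        ∑' n : ℕ, 4 * (1 / (n : ℝ) ^ (3 / 2 : ℝ)) :=
      hs.sum_le_tsum _ fun n _ => by positivity
    refine le_trans ?_ (mul_le_mul_of_nonneg_left (add_le_add_right hle _) (by linarith))
    rw [log_factorial_eq_sum_padicValNat, primeLogSum, ← Finset.sum_add_distrib, Finset.mul_sum]
    refine Finset.sum_le_sum fun p hp => ?_
    have hpp : p.Prime := (Finset.mem_filter.1 hp).2
    have := Fact.mk hpp
    have hp2 : (2 : ℝ) ≤ p := by exact_mod_cast hpp.two_le
    have hv : ((p : ℝ) - 1) * padicValNat p N.factorial ≤ N := by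
      have h1 := sub_one_mul_padicValNat_factorial (p := p) N
      have h2 : (p - 1) * padicValNat p N.factorial ≤ N := by omega
      have h3 : (((p - 1 : ℕ) : ℝ)) * padicValNat p N.factorial ≤ N := by exact_mod_cast h2
      rwa [Nat.cast_sub hpp.one_lt.le, Nat.cast_one] at h3
    have hlog : 0 ≤ Real.log p := Real.log_natCast_nonneg p
    have hlog2 : Real.log p ≤ 2 * (p : ℝ) ^ (1 / 2 : ℝ) := by
      have := Real.log_le_rpow_div (x := (p : ℝ)) (by linarith) (ε := 1 / 2) (by norm_num)
      linarith
    have hpow : (p : ℝ) ^ (3 / 2 : ℝ) * (p : ℝ) ^ (1 / 2 : ℝ) = p ^ 2 := by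
      rw [← Real.rpow_add (by linarith)]; norm_num
    have h32 : 0 < (p : ℝ) ^ (3 / 2 : ℝ) := Real.rpow_pos_of_pos (by linarith) _
    have hb : Real.log p / (p - 1) ≤ Real.log p / p + 4 * (1 / (p : ℝ) ^ (3 / 2 : ℝ)) := by
      have e : Real.log p / (p - 1) = Real.log p / p + Real.log p / (p * (p - 1)) := by
        field_simp [show (p : ℝ) - 1 ≠ 0 by linarith]
        ring
      rw [e]
      gcongr
      rw [mul_one_div, div_le_div_iff₀ (by nlinarith) h32]
      calc Real.log p * (p : ℝ) ^ (3 / 2 : ℝ) ≤ 2 * (p : ℝ) ^ (1 / 2 : ℝ) * (p : ℝ) ^ (3 / 2 : ℝ) := by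
            gcongr
        _ = 2 * p ^ 2 := by rw [← hpow]; ring
        _ ≤ _ := by nlinarith
    calc (padicValNat p N.factorial : ℝ) * Real.log p
        ≤ (N : ℝ) / (p - 1) * Real.log p := by
          gcongr
          rw [le_div_iff₀ (by linarith)]
          linarith
      _ = N * (Real.log p / (p - 1)) := by ring
      _ ≤ _ := by gcongr
  have h1 := (le_log_factorial N).trans key
  have h2 : Real.log N - 1 ≤ primeLogSum t + ∑' n : ℕ, 4 * (1 / (n : ℝ) ^ (3 / 2 : ℝ)) := by
    by_contra! hc
    nlinarith
  have h3 : Real.log t ≤ Real.log N + 1 := by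
    have : Real.log t ≤ Real.log (N * 2) := Real.log_le_log (by linarith) (by linarith)
    rw [Real.log_mul (by linarith) (by norm_num)] at this
    linarith [Real.log_two_lt_d9]
  linarith

/-! ### Inclusion-exclusion and disjoint blocks of primes -/

/-- An alternating sum over subsets of `range k` that vanishes by inclusion-exclusion bounds the
product of the `1 - γ j`. -/
theorem mul_prod_one_sub_le {k Y : ℕ} {F : ℕ → ℕ → ℝ} {γ : ℕ → ℝ} {δ : ℝ}
    (hF : ∀ n ∈ Finset.Icc 1 Y, ∃ j ∈ Finset.range k, F j n = 1)
    (hδ : ∀ J ⊆ Finset.range k,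
      |∑ n ∈ Finset.Icc 1 Y, ∏ j ∈ J, F j n - (∏ j ∈ J, γ j) * Y| ≤ δ) :
    (∏ j ∈ Finset.range k, (1 - γ j)) * Y ≤ 2 ^ k * δ := by
  have expand : ∀ c : ℕ → ℝ, ∏ j ∈ Finset.range k, (1 - c j) =
      ∑ J ∈ (Finset.range k).powerset, (-1) ^ J.card * ∏ j ∈ J, c j := by
    intro c
    have := Finset.prod_one_add (f := fun j => -c j) (Finset.range k)
    simpa [sub_eq_add_neg, Finset.prod_neg] using this
  have hzero : ∑ J ∈ (Finset.range k).powerset,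
      (-1 : ℝ) ^ J.card * ∑ n ∈ Finset.Icc 1 Y, ∏ j ∈ J, F j n = 0 := by
    simp_rw [Finset.mul_sum]
    rw [Finset.sum_comm]
    refine Finset.sum_eq_zero fun n hn => ?_
    rw [← expand fun j => F j n]
    obtain ⟨j, hj, hjn⟩ := hF n hn
    exact Finset.prod_eq_zero hj (by simp [hjn])
  have heq : (∏ j ∈ Finset.range k, (1 - γ j)) * Y = ∑ J ∈ (Finset.range k).powerset,
      -((-1) ^ J.card * (∑ n ∈ Finset.Icc 1 Y, ∏ j ∈ J, F j n - (∏ j ∈ J, γ j) * Y)) := by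
    rw [expand, Finset.sum_neg_distrib]
    simp_rw [mul_sub]
    rw [Finset.sum_sub_distrib, hzero, Finset.sum_mul]
    simp [mul_assoc]
  rw [heq]
  calc _ ≤ ∑ J ∈ (Finset.range k).powerset, δ := by
        refine Finset.sum_le_sum fun J hJ => ?_
        refine le_trans (le_abs_self _) ?_
        rw [abs_neg, abs_mul, abs_pow, abs_neg, abs_one, one_pow, one_mul]
        exact hδ J (Finset.mem_powerset.1 hJ)
    _ = _ := by simp

/-- Greedy: elements are added one at a time, and the one that first brings the total to m
overshoots by at most m. -/
theorem exists_subset_sum_between {w : ℕ → ℝ} {m : ℝ} (hm : 0 ≤ m) (Q : Finset ℕ)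
    (hw : ∀ p ∈ Q, w p ≤ m) (hQ : m ≤ ∑ p ∈ Q, w p) :
    ∃ T ⊆ Q, m ≤ ∑ p ∈ T, w p ∧ ∑ p ∈ T, w p ≤ 2 * m := by
  induction Q using Finset.induction_on with
  | empty => exact ⟨∅, subset_rfl, hQ, by simpa using by linarith⟩
  | insert p Q hp ih =>
    by_cases h : m ≤ ∑ p ∈ Q, w p
    · obtain ⟨T, hT, h1, h2⟩ := ih (fun r hr => hw r (Finset.mem_insert_of_mem hr)) h
      exact ⟨T, hT.trans (Finset.subset_insert _ _), h1, h2⟩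
    · refine ⟨insert p Q, subset_rfl, hQ, ?_⟩
      rw [Finset.sum_insert hp]
      have := hw p (Finset.mem_insert_self _ _)
      linarith

/-- A set of small weights with large total splits off `k` disjoint blocks of weight at least
`m`. -/
theorem exists_disjoint_blocks {w : ℕ → ℝ} {m : ℝ} (hm : 0 ≤ m) (k : ℕ) (Q : Finset ℕ)
    (hw : ∀ p ∈ Q, w p ≤ m) (hQ : 2 * k * m ≤ ∑ p ∈ Q, w p) :
    ∃ B : ℕ → Finset ℕ, (∀ j, B j ⊆ Q) ∧ Pairwise (fun i j => Disjoint (B i) (B j)) ∧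
      ∀ j < k, m ≤ ∑ p ∈ B j, w p := by
  induction k generalizing Q with
  | zero => exact ⟨fun _ => ∅, by simp, fun _ _ _ => by simp, by simp⟩
  | succ k ih =>
    push_cast at hQ
    have hk : 0 ≤ (k : ℝ) * m := by positivity
    obtain ⟨T, hT, h1, h2⟩ := exists_subset_sum_between hm Q hw (by linarith)
    have hsd := Finset.sum_sdiff (f := w) hT
    obtain ⟨B, hB, hd, hs⟩ := ih (Q \ T) (fun p hp => hw p (Finset.sdiff_subset hp))
      (by linarith)
    refine ⟨fun j => Nat.casesOn j T B, ?_, ?_, ?_⟩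
    · rintro (_ | j)
      · exact hT
      · exact (hB j).trans Finset.sdiff_subset
    · have hTB : ∀ j, Disjoint T (B j) := fun j =>
        Finset.disjoint_of_subset_right (hB j) Finset.disjoint_sdiff
      rintro (_ | i) (_ | j) hij
      · exact absurd rfl hij
      · exact hTB j
      · exact (hTB i).symm
      · exact hd (by simpa using hij)
    · rintro (_ | j) hj
      · exact h1
      · exact hs j (by omega)

/-- An integer divisible by a prime from each of `k` disjoint sets of primes exceeding `z` is
larger than `z ^ k`. -/
theorem pow_lt_of_forall_exists_dvd {z : ℝ} (hz : 0 ≤ z) {k n : ℕ} (hk : k ≠ 0) (hn : n ≠ 0)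
    {B : ℕ → Finset ℕ} (hB : ∀ j, ∀ p ∈ B j, p.Prime ∧ z < p)
    (hd : Pairwise fun i j => Disjoint (B i) (B j)) (h : ∀ j < k, ∃ p ∈ B j, p ∣ n) :
    z ^ k < n := by
  have : ∀ j, ∃ p, j < k → p ∈ B j ∧ p ∣ n := fun j => by
    by_cases hj : j < k
    · obtain ⟨p, hp⟩ := h j hj
      exact ⟨p, fun _ => hp⟩
    · exact ⟨0, fun h => absurd h hj⟩
  choose P hP using this
  -- The chosen primes are distinct because the blocks are disjoint.
  have hdvd : ∏ j ∈ Finset.range k, P j ∣ n := by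
    refine Finset.prod_dvd_of_isRelPrime ?_ fun j hj => (hP j (Finset.mem_range.1 hj)).2
    · intro i hi j hj hij
      have h1 := (hP i (by simpa using hi)).1
      have h2 := (hP j (by simpa using hj)).1
      refine Nat.coprime_iff_isRelPrime.1 <| (Nat.coprime_primes (hB i _ h1).1 (hB j _ h2).1).2 fun he => ?_
      exact Finset.disjoint_left.1 (hd hij) h1 (he ▸ h2)
  have hle : ((∏ j ∈ Finset.range k, P j : ℕ) : ℝ) ≤ n := by
    exact_mod_cast Nat.le_of_dvd (Nat.pos_of_ne_zero hn) hdvd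
  refine lt_of_lt_of_le ?_ hle
  rw [Nat.cast_prod]
  rcases hz.eq_or_lt with rfl | hz'
  · rw [zero_pow hk]
    refine Finset.prod_pos fun j hj => ?_
    exact (hB j _ (hP j (Finset.mem_range.1 hj)).1).2
  calc z ^ k = ∏ j ∈ Finset.range k, z := by simp
    _ < _ := Finset.prod_lt_prod_of_nonempty (fun _ _ => hz')
        (fun j hj => (hB j _ (hP j (Finset.mem_range.1 hj)).1).2)
        (Finset.nonempty_range_iff.2 hk)

/-! ### The functions f_q and γ_q for squarefree q -/

namespace ArithSeq

theorem primeFactors_gcd_prod {T : Finset ℕ} (hT : ∀ p ∈ T, p.Prime) (b : ℕ) :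
    (Nat.gcd b (∏ p ∈ T, p)).primeFactors = T.filter (· ∣ b) := by
  have hq : ∏ p ∈ T, p ≠ 0 := Finset.prod_ne_zero_iff.2 fun p hp => (hT p hp).ne_zero
  ext p
  simp only [Nat.mem_primeFactors, Finset.mem_filter, Nat.dvd_gcd_iff]
  constructor
  · rintro ⟨hp, ⟨h1, h2⟩, -⟩
    obtain ⟨r, hr, hpr⟩ := (hp.prime.dvd_finsetProd_iff _).1 h2
    rw [(Nat.prime_dvd_prime_iff_eq hp (hT r hr)).1 hpr] at h1 ⊢
    exact ⟨hr, h1⟩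
  · rintro ⟨hp, hb⟩
    exact ⟨hT p hp, ⟨hb, Finset.dvd_prod_of_mem _ hp⟩, Nat.gcd_ne_zero_right hq⟩

theorem squarefree_prod_of_primes {T : Finset ℕ} (hT : ∀ p ∈ T, p.Prime) :
    Squarefree (∏ p ∈ T, p) := by
  refine Finset.squarefree_prod_of_pairwise_isCoprime ?_ fun p hp => (hT p hp).prime.squarefree
  intro p hp r hr hpr
  exact Nat.coprime_iff_isRelPrime.1 ((Nat.coprime_primes (hT p hp) (hT r hr)).2 hpr)

/-- For squarefree q every exponent e is 1, so a prime dividing b always falls in the case k ≥ e.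
This makes f_q multiplicative over disjoint blocks. -/
theorem f_prod {T : Finset ℕ} (hT : ∀ p ∈ T, p.Prime) (h : ArithmeticFunction ℝ) (b : ℕ) :
    f h (∏ p ∈ T, p) b =
      ∏ p ∈ T, if p ∣ b then h p * (1 - 1 / (p : ℝ)) * (1 - h p / p)⁻¹ else 1 := by
  have hsq := squarefree_prod_of_primes hT
  have key : ∀ {n p : ℕ}, Squarefree n → p.Prime → p ∣ n → n.factorization p = 1 := by
    intro n p hn hp hpn
    have h1 := hn.natFactorization_le_one p
    have h2 := hp.factorization_pos_of_dvd hn.ne_zero hpn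
    omega
  rw [f, Finsupp.prod, Nat.support_factorization, primeFactors_gcd_prod hT, Finset.prod_filter]
  refine Finset.prod_congr rfl fun p hp => ?_
  split_ifs with hb
  · have hpq : p ∣ ∏ p ∈ T, p := Finset.dvd_prod_of_mem _ hp
    rw [key (hsq.squarefree_of_dvd (Nat.gcd_dvd_right _ _)) (hT p hp) (Nat.dvd_gcd hb hpq),
      fPrimePow, key hsq (hT p hp) hpq]
    simp [hpq]
  · rfl

theorem gam_prod {T : Finset ℕ} (hT : ∀ p ∈ T, p.Prime) (h : ArithmeticFunction ℝ) :
    gam h (∏ p ∈ T, p) = ∏ p ∈ T, ((p : ℝ) - 1) / ((p : ℝ) - h p) := by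
  rw [gam, Nat.primeFactors_prod hT]

theorem gam_factor_le {h : ArithmeticFunction ℝ} (hh : ∀ n, 0 ≤ h n ∧ h n ≤ 1) {p : ℕ}
    (hp : p.Prime) :
    0 < ((p : ℝ) - 1) / ((p : ℝ) - h p) ∧
      ((p : ℝ) - 1) / ((p : ℝ) - h p) ≤ Real.exp (-((1 - h p) / p)) := by
  have hp2 : (2 : ℝ) ≤ p := by exact_mod_cast hp.two_le
  obtain ⟨h0, h1⟩ := hh p
  have hd : 0 < (p : ℝ) - h p := by linarith
  refine ⟨div_pos (by linarith) hd, ?_⟩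
  have hle : (1 - h p) / p ≤ (1 - h p) / (p - h p) := by
    apply div_le_div_of_nonneg_left <;> linarith
  have heq : ((p : ℝ) - 1) / ((p : ℝ) - h p) = 1 - (1 - h p) / (p - h p) := by
    field_simp
    ring
  have := Real.add_one_le_exp (-((1 - h p) / p))
  linarith

theorem prod_gam_factor_le {h : ArithmeticFunction ℝ} (hh : ∀ n, 0 ≤ h n ∧ h n ≤ 1) {T : Finset ℕ}
    (hT : ∀ p ∈ T, p.Prime) :
    0 < ∏ p ∈ T, ((p : ℝ) - 1) / ((p : ℝ) - h p) ∧
      ∏ p ∈ T, ((p : ℝ) - 1) / ((p : ℝ) - h p) ≤ Real.exp (-∑ p ∈ T, (1 - h p) / (p : ℝ)) := by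
  refine ⟨Finset.prod_pos fun p hp => (gam_factor_le hh (hT p hp)).1, ?_⟩
  rw [← Finset.sum_neg_distrib, Real.exp_sum]
  exact Finset.prod_le_prod (fun p hp => (gam_factor_le hh (hT p hp)).1.le)
    fun p hp => (gam_factor_le hh (hT p hp)).2

/-! ### Maier's matrix -/

theorem sum_add_sub_sum (a : ℕ → ℝ) (m Y : ℕ) :
    sum a ((m : ℝ) + Y) - sum a m = ∑ s ∈ Finset.Icc 1 Y, a (m + s) := by
  have hfl : ∀ Y : ℕ, ⌊(m : ℝ) + Y⌋₊ = m + Y := fun Y => by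
    exact_mod_cast Nat.floor_natCast (R := ℝ) (m + Y)
  induction Y with
  | zero => simp
  | succ Y ih =>
    rw [Finset.sum_Icc_succ_top (by omega), ← ih]
    simp only [sum, hfl, Nat.floor_natCast]
    rw [← add_assoc, Finset.sum_Icc_succ_top (by omega)]
    ring

theorem sumAP_add_sub_sumAP (a : ℕ → ℝ) {q : ℕ} (hq : 0 < q) (r s : ℕ) :
    sumAP a ((q * (r + 1) + s : ℕ) : ℝ) q s - sumAP a ((q * r + s : ℕ) : ℝ) q s =
      a (q * (r + 1) + s) := by
  rw [sumAP, sumAP, Nat.floor_natCast, Nat.floor_natCast]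
  have : (Finset.Icc 1 (q * (r + 1) + s)).filter (fun n => n ≡ s [MOD q]) =
      insert (q * (r + 1) + s) ((Finset.Icc 1 (q * r + s)).filter fun n => n ≡ s [MOD q]) := by
    have hmod : q * (r + 1) + s ≡ s [MOD q] := by simp [Nat.ModEq]
    ext n
    simp only [Finset.mem_filter, Finset.mem_Icc, Finset.mem_insert]
    constructor
    · rintro ⟨⟨h1, h2⟩, h3⟩
      by_cases h : n ≤ q * r + s
      · exact Or.inr ⟨⟨h1, h⟩, h3⟩
      · left
        have h4 : q ∣ (q * (r + 1) + s) - n := (Nat.modEq_iff_dvd' h2).1 (h3.trans hmod.symm)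
        rw [mul_add] at h2 h4 ⊢
        have := Nat.eq_zero_of_dvd_of_lt h4 (by omega)
        omega
    · rintro (rfl | ⟨⟨h1, h2⟩, h3⟩)
      · exact ⟨⟨by nlinarith, le_rfl⟩, hmod⟩
      · exact ⟨⟨h1, by rw [mul_add]; omega⟩, h3⟩
  rw [this, Finset.sum_insert]
  · ring
  · simp only [Finset.mem_filter, Finset.mem_Icc, mul_add]
    omega

/-- Maier's matrix method: if a sequence is well distributed in intervals of length `Y` and in the
residue classes modulo `q`, then the mean value of `F` over `[1, Y]` is close to `γ`. -/
theorem abs_sum_sub_le_of_maier {a : ℕ → ℝ} {x A ε γ : ℝ} {q Y : ℕ} {F : ℕ → ℝ} (hx : 0 < x)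
    (hA : 0 < A) (hq : 0 < q) (hγ : 0 < γ) (hε : 0 ≤ ε)
    (hqx : 16 * (q : ℝ) ≤ x) (hYx : 16 * (Y : ℝ) ≤ x)
    (hrow : ∀ m : ℕ, x / 4 ≤ m → (m : ℝ) + Y ≤ x →
      |sum a ((m : ℝ) + Y) - sum a m - Y * (A / x)| ≤ ε * (Y * (A / x)))
    (hcol : ∀ n b : ℕ, x / 4 < n → (n : ℝ) < x →
      |sumAP a n q b - F b / (q * γ) * (n * (A / x))| ≤ ε * (A / (Nat.totient q : ℝ))) :
    |∑ s ∈ Finset.Icc 1 Y, F s - γ * Y| ≤ γ * (ε * (1 + 16 * ((q : ℝ) / Nat.totient q)) * Y) := by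
  have hqR : (1 : ℝ) ≤ q := by exact_mod_cast hq
  have hφ : (0 : ℝ) < Nat.totient q := by exact_mod_cast Nat.totient_pos.2 hq
  -- Rows start at q(R₀ + r + 1) with r < R. Both R₀ and R are about x/(4q), so the rows begin past
  -- x/4 and end before x.
  set R₀ := ⌈x / (4 * q)⌉₊ with hR₀
  set R := ⌊x / (4 * q)⌋₊ with hR
  have h0 : 0 ≤ x / (4 * q) := by positivity
  have hR₀l : x / 4 ≤ q * R₀ := by
    have := Nat.le_ceil (x / (4 * q))
    rw [div_le_iff₀ (by positivity)] at this
    linarith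
  have hR₀u : (q : ℝ) * R₀ ≤ x / 4 + q := by
    have := (Nat.ceil_lt_add_one h0).le
    calc (q : ℝ) * R₀ ≤ q * (x / (4 * q) + 1) := by gcongr
      _ = _ := by field_simp
  have hRu : (q : ℝ) * R ≤ x / 4 := by
    have := Nat.floor_le h0
    rw [le_div_iff₀ (by positivity)] at this
    linarith
  have hRl : x ≤ 8 * q * R := by
    have := (Nat.lt_floor_add_one (x / (4 * q))).le
    rw [div_le_iff₀ (by positivity)] at this
    linarith
  have hRpos : (0 : ℝ) < R := by
    by_contra! hc
    nlinarith
  set M := ∑ r ∈ Finset.range R, ∑ s ∈ Finset.Icc 1 Y, a (q * (R₀ + r + 1) + s) with hM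
  set α := A / x with hα
  have hαpos : 0 < α := div_pos hA hx
  have hrows : |M - R * (Y * α)| ≤ R * (ε * (Y * α)) := by
    have : M - R * (Y * α) = ∑ r ∈ Finset.range R,
        (∑ s ∈ Finset.Icc 1 Y, a (q * (R₀ + r + 1) + s) - Y * α) := by
      rw [Finset.sum_sub_distrib]; simp [hM]
    rw [this]
    refine (Finset.abs_sum_le_sum_abs _ _).trans ?_
    calc _ ≤ ∑ r ∈ Finset.range R, ε * (Y * α) := by
          refine Finset.sum_le_sum fun r hr => ?_
          have hr' : ((r + 1 : ℕ) : ℝ) ≤ R := by exact_mod_cast Finset.mem_range.1 hr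
          rw [← sum_add_sub_sum]
          have hqr : (q : ℝ) * ((r : ℝ) + 1) ≤ q * R := by
            push_cast at hr'; gcongr
          have hqr' : 0 ≤ (q : ℝ) * ((r : ℝ) + 1) := by positivity
          refine hrow _ ?_ ?_
          · push_cast; linarith
          · push_cast; linarith
      _ = _ := by simp
  -- A column sum is a difference of two counts in the progression s mod q, hence the factor 2.
  have hcols : |M - ∑ s ∈ Finset.Icc 1 Y, F s / γ * (R * α)| ≤
      Y * (2 * (ε * (A / (Nat.totient q : ℝ)))) := by
    rw [hM, Finset.sum_comm, ← Finset.sum_sub_distrib]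
    refine (Finset.abs_sum_le_sum_abs _ _).trans ?_
    calc _ ≤ ∑ s ∈ Finset.Icc 1 Y, 2 * (ε * (A / (Nat.totient q : ℝ))) := by
          refine Finset.sum_le_sum fun s hs => ?_
          obtain ⟨hs1, hs2⟩ := Finset.mem_Icc.1 hs
          have hs1' : (1 : ℝ) ≤ s := by exact_mod_cast hs1
          have hs2' : (s : ℝ) ≤ Y := by exact_mod_cast hs2
          have htel : ∑ r ∈ Finset.range R, a (q * (R₀ + r + 1) + s) =
              sumAP a ((q * (R₀ + R) + s : ℕ) : ℝ) q s -
                sumAP a ((q * R₀ + s : ℕ) : ℝ) q s := by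
            have := Finset.sum_range_sub
              (fun r => sumAP a ((q * (R₀ + r) + s : ℕ) : ℝ) q s) R
            rw [add_zero] at this
            rw [← this]
            exact Finset.sum_congr rfl fun r _ => (sumAP_add_sub_sumAP a hq (R₀ + r) s).symm
          rw [htel]
          have hqR0 : 0 ≤ (q : ℝ) * R := by positivity
          have h1 := hcol (q * (R₀ + R) + s) s (by push_cast; linarith) (by push_cast; linarith)
          have h2 := hcol (q * R₀ + s) s (by push_cast; linarith) (by push_cast; linarith)
          have e : F s / γ * (R * α) =
              F s / (q * γ) * (((q * (R₀ + R) + s : ℕ) : ℝ) * α) -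
                F s / (q * γ) * (((q * R₀ + s : ℕ) : ℝ) * α) := by
            push_cast
            field_simp
            ring
          rw [e]
          rw [abs_le] at h1 h2 ⊢
          constructor <;> linarith [h1.1, h1.2, h2.1, h2.2]
      _ = _ := by simp
  rw [← Finset.sum_mul, ← Finset.sum_div] at hcols
  set V := ∑ s ∈ Finset.Icc 1 Y, F s with hV
  have hcomb : |V / γ * (R * α) - R * (Y * α)| ≤
      R * (ε * (Y * α)) + Y * (2 * (ε * (A / (Nat.totient q : ℝ)))) := by
    rw [abs_le] at hrows hcols ⊢
    constructor <;> linarith [hrows.1, hrows.2, hcols.1, hcols.2]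
  have hAα : A = α * x := by rw [hα]; field_simp
  have hfac : V / γ * (R * α) - R * (Y * α) = (V - γ * Y) * (R * α / γ) := by
    field_simp
  rw [hfac, abs_mul, abs_of_pos (show 0 < R * α / γ by positivity)] at hcomb
  -- Expressing A through R, via x ≤ 8qR, makes all terms proportional to R; 16 = 2 · 8.
  have hlast : Y * (2 * (ε * (A / (Nat.totient q : ℝ)))) ≤
      Y * (2 * (ε * (α * (8 * q * R) / (Nat.totient q : ℝ)))) := by
    rw [hAα]; gcongr
  have hpos : 0 < R * α / γ := by positivity
  refine le_of_mul_le_mul_right (hcomb.trans ((add_le_add_right hlast _).trans (le_of_eq ?_))) hpos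
  field_simp
  ring

end ArithSeq

/-! ### Primes in the middle range -/

/-- The primes `p` with `L ^ η < p ≤ L ^ (1 - η)`. -/
noncomputable def middlePrimes (L η : ℝ) : Finset ℕ :=
  {p ∈ Finset.Icc 1 ⌊L ^ (1 - η)⌋₊ | p.Prime ∧ L ^ η < p}

theorem mem_middlePrimes {L η : ℝ} {p : ℕ} (hL : 0 ≤ L) :
    p ∈ middlePrimes L η ↔ p.Prime ∧ L ^ η < p ∧ (p : ℝ) ≤ L ^ (1 - η) := by
  rw [middlePrimes, Finset.mem_filter, Finset.mem_Icc, Nat.le_floor_iff (Real.rpow_nonneg hL _)]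
  constructor
  · rintro ⟨⟨-, h1⟩, h2, h3⟩
    exact ⟨h2, h3, h1⟩
  · rintro ⟨h2, h3, h1⟩
    exact ⟨⟨h2.one_lt.le, h1⟩, h2, h3⟩

/-- Since 0 ≤ 1 - h ≤ 1, Mertens shows that each of the discarded ranges p ≤ L^η and L^(1-η) < p ≤ L
costs at most η log L + O(1), out of at least 3η log L. -/
theorem exists_le_sum_middlePrimes : ∃ K : ℝ, ∀ (L η α : ℝ) (h : ℕ → ℝ), 1 < L → 0 < η → η < 1 →
    3 * η ≤ α → (∀ n, 0 ≤ h n ∧ h n ≤ 1) →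
    α * Real.log L ≤ ∑ p ∈ Finset.Icc 1 ⌊L⌋₊ with p.Prime, (1 - h p) / (p : ℝ) * Real.log p →
    η * Real.log L - K ≤ ∑ p ∈ middlePrimes L η, (1 - h p) / (p : ℝ) * Real.log p := by
  obtain ⟨C, hC⟩ := exists_le_primeLogSum
  refine ⟨2 * Real.log 4 + C, fun L η α h hL hη hη1 hα hh hsum => ?_⟩
  have hl : 0 < Real.log L := Real.log_pos hL
  have hL0 : 0 < L := by linarith
  have hw0 : ∀ p : ℕ, 0 ≤ (1 - h p) / (p : ℝ) * Real.log p := fun p =>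
    mul_nonneg (div_nonneg (by linarith [(hh p).2]) (Nat.cast_nonneg _)) (Real.log_natCast_nonneg _)
  have hw1 : ∀ p : ℕ, (1 - h p) / (p : ℝ) * Real.log p ≤ Real.log p / p := fun p => by
    have : 0 ≤ Real.log p / (p : ℝ) := div_nonneg (Real.log_natCast_nonneg _) (Nat.cast_nonneg _)
    calc (1 - h p) / (p : ℝ) * Real.log p = (1 - h p) * (Real.log p / p) := by ring
      _ ≤ 1 * (Real.log p / p) := by gcongr; linarith [(hh p).1]
      _ = _ := one_mul _
  have ha : 1 ≤ L ^ η := Real.one_le_rpow hL.le hη.le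
  have hb : 1 ≤ L ^ (1 - η) := Real.one_le_rpow hL.le (by linarith)
  have hbL : L ^ (1 - η) ≤ L := by
    conv_rhs => rw [← Real.rpow_one L]
    exact Real.rpow_le_rpow_of_exponent_le hL.le (by linarith)
  set I : ℝ → Finset ℕ := fun t => (Finset.Icc 1 ⌊t⌋₊).filter Nat.Prime with hI
  have hsub : I (L ^ (1 - η)) ⊆ I L := Finset.filter_subset_filter _
    (Finset.Icc_subset_Icc_right (Nat.floor_mono hbL))
  have hcover : I L ⊆ (middlePrimes L η ∪ I (L ^ η)) ∪ (I L \ I (L ^ (1 - η))) := by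
    intro p hp
    have hp' := hp
    simp only [hI, Finset.mem_union, mem_middlePrimes hL0.le, Finset.mem_filter, Finset.mem_Icc,
      Finset.mem_sdiff, Nat.le_floor_iff (Real.rpow_nonneg hL0.le _)] at hp hp' ⊢
    by_cases h1 : (p : ℝ) ≤ L ^ η <;> by_cases h2 : (p : ℝ) ≤ L ^ (1 - η) <;>
      simp_all
  have htail : ∑ p ∈ I L \ I (L ^ (1 - η)), Real.log p / (p : ℝ) =
      primeLogSum L - primeLogSum (L ^ (1 - η)) := by
    rw [primeLogSum, primeLogSum, ← Finset.sum_sdiff hsub, add_sub_cancel_right]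
  have h1 := primeLogSum_le ha
  have h2 := primeLogSum_le hL.le
  have h3 := hC _ hb
  rw [Real.log_rpow hL0] at h1 h3
  have hdisj : ∀ s t : Finset ℕ, ∑ p ∈ s ∪ t, (1 - h p) / (p : ℝ) * Real.log p ≤
      ∑ p ∈ s, (1 - h p) / (p : ℝ) * Real.log p + ∑ p ∈ t, (1 - h p) / (p : ℝ) * Real.log p := by
    intro s t
    rw [← Finset.sum_union_inter]
    exact le_add_of_nonneg_right (Finset.sum_nonneg fun p _ => hw0 p)
  have h4 : α * Real.log L ≤ ∑ p ∈ middlePrimes L η, (1 - h p) / (p : ℝ) * Real.log p +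
      primeLogSum (L ^ η) + (primeLogSum L - primeLogSum (L ^ (1 - η))) := by
    refine hsum.trans ((Finset.sum_le_sum_of_subset_of_nonneg hcover fun p _ _ => hw0 p).trans ?_)
    refine (hdisj _ _).trans (add_le_add ((hdisj _ _).trans (add_le_add le_rfl ?_)) ?_)
    · exact Finset.sum_le_sum fun p _ => hw1 p
    · rw [← htail]
      exact Finset.sum_le_sum fun p _ => hw1 p
  have h5 : 3 * η * Real.log L ≤ α * Real.log L := by gcongr
  linarith

/-- Every prime here has log p > η log L, while Mertens bounds ∑ log p / p by 2 log L. This controls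
q/φ(q). -/
theorem sum_one_div_middlePrimes_le {L η : ℝ} (hL : 1 < L) (hη : 0 < η)
    (hl : Real.log 4 ≤ Real.log L) (hη1 : η < 1) :
    ∑ p ∈ middlePrimes L η, 1 / (p : ℝ) ≤ 2 / η := by
  have hL0 : 0 < L := by linarith
  have hl0 : 0 < Real.log L := Real.log_pos hL
  have hbL : L ^ (1 - η) ≤ L := by
    conv_rhs => rw [← Real.rpow_one L]
    exact Real.rpow_le_rpow_of_exponent_le hL.le (by linarith)
  have h1 : ∑ p ∈ middlePrimes L η, Real.log p / (p : ℝ) ≤ primeLogSum L := by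
    refine Finset.sum_le_sum_of_subset_of_nonneg ?_ fun p _ _ =>
      div_nonneg (Real.log_natCast_nonneg _) (Nat.cast_nonneg _)
    intro p hp
    rw [mem_middlePrimes hL0.le] at hp
    simp only [Finset.mem_filter, Finset.mem_Icc, Nat.le_floor_iff hL0.le]
    exact ⟨⟨hp.1.one_lt.le, hp.2.2.trans hbL⟩, hp.1⟩
  have h2 : ∑ p ∈ middlePrimes L η, 1 / (p : ℝ) ≤
      ∑ p ∈ middlePrimes L η, Real.log p / (p : ℝ) / (η * Real.log L) := by
    refine Finset.sum_le_sum fun p hp => ?_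
    rw [mem_middlePrimes hL0.le] at hp
    have hp0 : (0 : ℝ) < p := by exact_mod_cast hp.1.pos
    have h3 := Real.log_le_log (Real.rpow_pos_of_pos hL0 _) hp.2.1.le
    rw [Real.log_rpow hL0] at h3
    rw [div_div, mul_comm (p : ℝ), ← div_div]
    gcongr
    rwa [one_le_div (by positivity)]
  rw [← Finset.sum_div] at h2
  refine h2.trans ?_
  rw [div_le_div_iff₀ (by positivity) hη]
  have h3 := primeLogSum_le hL.le
  nlinarith

/-- Factor by factor, (1 + 2/p)(1 - 1/p) ≥ 1 for p ≥ 2. -/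
theorem prod_div_totient_le {T : Finset ℕ} (hT : ∀ p ∈ T, p.Prime) :
    ((∏ p ∈ T, p : ℕ) : ℝ) / Nat.totient (∏ p ∈ T, p) ≤
      Real.exp (2 * ∑ p ∈ T, 1 / (p : ℝ)) := by
  have hq : 0 < ∏ p ∈ T, p := Finset.prod_pos fun p hp => (hT p hp).pos
  have h1 : (Nat.totient (∏ p ∈ T, p) : ℝ) = ((∏ p ∈ T, p : ℕ) : ℝ) * ∏ p ∈ T, (1 - (p : ℝ)⁻¹) := by
    have := Nat.totient_eq_mul_prod_factors (∏ p ∈ T, p)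
    rw [Nat.primeFactors_prod hT] at this
    have h := congrArg (Rat.cast (K := ℝ)) this
    push_cast at h ⊢
    exact h
  have hφ : (0 : ℝ) < Nat.totient (∏ p ∈ T, p) := by exact_mod_cast Nat.totient_pos.2 hq
  rw [div_le_iff₀ hφ, h1]
  have h2 : 1 ≤ Real.exp (2 * ∑ p ∈ T, 1 / (p : ℝ)) * ∏ p ∈ T, (1 - (p : ℝ)⁻¹) := by
    rw [Finset.mul_sum, Real.exp_sum, ← Finset.prod_mul_distrib]
    refine le_trans (le_of_eq Finset.prod_const_one.symm)
      (Finset.prod_le_prod (fun _ _ => zero_le_one) fun p hp => ?_)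
    have hp2 : (2 : ℝ) ≤ p := by exact_mod_cast (hT p hp).two_le
    have h3 := Real.add_one_le_exp (2 * (1 / (p : ℝ)))
    have hi : (p : ℝ)⁻¹ ≤ 1 / 2 := by rw [one_div]; gcongr
    have hi0 : 0 < (p : ℝ)⁻¹ := by positivity
    rw [one_div] at h3 ⊢
    calc (1 : ℝ) ≤ (2 * (p : ℝ)⁻¹ + 1) * (1 - (p : ℝ)⁻¹) := by nlinarith
      _ ≤ _ := by gcongr; linarith
  have hq' : (0 : ℝ) < ((∏ p ∈ T, p : ℕ) : ℝ) := by exact_mod_cast hq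
  nlinarith

/-- The product divides a primorial, and θ(t) ≤ t log 4 ≤ 2t. -/
theorem prod_primes_le_exp {T : Finset ℕ} {t : ℝ} (ht : 0 ≤ t)
    (hT : ∀ p ∈ T, p.Prime ∧ (p : ℝ) ≤ t) : ((∏ p ∈ T, p : ℕ) : ℝ) ≤ Real.exp (2 * t) := by
  have hdvd : ∏ p ∈ T, p ∣ primorial ⌊t⌋₊ := by
    refine Finset.prod_dvd_prod_of_subset _ _ _ fun p hp => ?_
    simp only [Finset.mem_filter, Finset.mem_range, Nat.lt_succ_iff, Nat.le_floor_iff ht]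
    exact ⟨(hT p hp).2, (hT p hp).1⟩
  have hle : ((∏ p ∈ T, p : ℕ) : ℝ) ≤ primorial ⌊t⌋₊ := by
    exact_mod_cast Nat.le_of_dvd (primorial_pos _) hdvd
  have hpos : (0 : ℝ) < primorial ⌊t⌋₊ := by exact_mod_cast primorial_pos _
  have h1 := Chebyshev.theta_le_log4_mul_x ht
  rw [Chebyshev.theta_eq_log_primorial, Real.log_le_iff_le_exp hpos] at h1
  have h4 : Real.log 4 ≤ 2 := by
    rw [show (4 : ℝ) = 2 ^ 2 by norm_num, Real.log_pow]
    push_cast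
    linarith [Real.log_two_lt_d9]
  exact hle.trans (h1.trans (Real.exp_le_exp.2 (by gcongr)))

/-! ### Numerical comparisons -/

/-- Put Λ = log(2u/η³). As 10k/η ≤ 20u/η² ≤ 2u/η³, the right side is at least exp(-(u/η + 2)Λ). The
25η on the left saves 25uΛ, which swallows both 2Λ and 4/η ≤ u. -/
theorem exp_mul_exp_lt_pow {η u : ℝ} {k : ℕ} (hη : 0 < η) (hη1 : η ≤ 1 / 100)
    (hu : 5 / η ^ 2 ≤ u) (hk : 0 < k) (hku : (k : ℝ) ≤ u / η + 2) :
    Real.exp (-(u / η) * (1 + 25 * η) * Real.log (2 * u / η ^ 3)) * Real.exp (4 / η) <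
      (η / (10 * k)) ^ k := by
  have hkR : (0 : ℝ) < k := by exact_mod_cast hk
  have hη2 : 0 < η ^ 2 := by positivity
  have h5 : 5 ≤ u * η ^ 2 := by rwa [div_le_iff₀ hη2] at hu
  have hu0 : 0 < u := by
    have : 0 < 5 / η ^ 2 := by positivity
    linarith
  have huη : 500 ≤ u * η := by nlinarith
  have huη' : 2 ≤ u / η := by
    rw [le_div_iff₀ hη]; nlinarith
  set Λ := Real.log (2 * u / η ^ 3) with hΛ
  have hΛ1 : 1 ≤ Λ := by
    rw [hΛ, Real.le_log_iff_exp_le (by positivity), le_div_iff₀ (by positivity)]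
    have := Real.exp_one_lt_d9
    have h6 : η ^ 3 ≤ 1 := pow_le_one₀ hη.le (by linarith)
    have hη3 : 0 < η ^ 3 := by positivity
    nlinarith
  have hlog : Real.log (10 * k / η) ≤ Λ := by
    refine Real.log_le_log (by positivity) ?_
    calc 10 * (k : ℝ) / η ≤ 10 * (2 * (u / η)) / η := by gcongr; linarith
      _ = 2 * u / η ^ 3 * (10 * η) := by field_simp
      _ ≤ 2 * u / η ^ 3 * 1 := by gcongr; linarith
      _ = _ := mul_one _
  have hrhs : (η / (10 * k)) ^ k = Real.exp (-(k * Real.log (10 * k / η))) := by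
    rw [Real.exp_neg, Real.exp_nat_mul, Real.exp_log (by positivity),
      ← inv_pow, inv_div]
  rw [hrhs, ← Real.exp_add, Real.exp_lt_exp]
  have h7 : k * Real.log (10 * k / η) ≤ (u / η + 2) * Λ := by
    calc _ ≤ (k : ℝ) * Λ := by gcongr
      _ ≤ _ := by gcongr
  have h8 : -(u / η) * (1 + 25 * η) * Λ = -(u / η) * Λ - 25 * u * Λ := by
    field_simp
    ring
  have h9 : 4 / η ≤ u := by
    rw [div_le_iff₀ hη]; linarith
  have h10 : 500 ≤ u := by nlinarith
  nlinarith

theorem exists_threshold (K : ℝ) : ∃ ℓ₀ : ℝ, 6 ≤ ℓ₀ ∧ ∀ ℓ : ℝ, ℓ₀ ≤ ℓ →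
    1 ≤ Real.log ℓ ∧ K ≤ Real.log ℓ ∧ 20 * Real.log ℓ ≤ 1 / 100 * ℓ := by
  have h1 := Real.tendsto_log_atTop.eventually_ge_atTop (max 1 K)
  have h2 := Real.isLittleO_log_id_atTop.bound (show (0 : ℝ) < 1 / 2000 by norm_num)
  obtain ⟨ℓ₀, h⟩ := Filter.eventually_atTop.1 (h1.and (h2.and (Filter.eventually_ge_atTop 6)))
  refine ⟨max ℓ₀ 6, le_max_right _ _, fun ℓ hℓ => ?_⟩
  obtain ⟨h3, h4, h5⟩ := h ℓ ((le_max_left _ _).trans hℓ)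
  have h6 : 1 ≤ Real.log ℓ := (le_max_left _ _).trans h3
  rw [Real.norm_of_nonneg (by linarith), id, Real.norm_of_nonneg (by linarith)] at h4
  exact ⟨h6, (le_max_right _ _).trans h3, by linarith⟩

/-! ### Irregularity of f_q on short intervals -/

/-- If some weight `1 - h p` sits on the primes in `(L ^ η, L ^ (1 - η)]`, then for some squarefree
`q` composed of them the sum of `f_q` over `[1, Y]`, `Y ≤ L ^ (η k)`, is not too close
to `γ_q Y`. -/
theorem exists_subset_lt_abs_sum_f_sub {L η δ : ℝ} {k Y : ℕ} (h : ArithmeticFunction ℝ)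
    (hh : ∀ n, 0 ≤ h n ∧ h n ≤ 1) (hL : 1 < L) (hη : 0 < η) (hη1 : η ≤ 1) (hk : 0 < k) (hY : 0 < Y)
    (hw : 5 * k ≤ 2 * η * L ^ η) (hYk : (Y : ℝ) ≤ (L ^ η) ^ k)
    (hmass : 9 / 10 * (η * Real.log L) ≤
      ∑ p ∈ middlePrimes L η, (1 - h p) / (p : ℝ) * Real.log p)
    (hδ : δ < (η / (10 * k)) ^ k) :
    ∃ T ⊆ middlePrimes L η, δ * Y <
      |∑ n ∈ Finset.Icc 1 Y, ArithSeq.f h (∏ p ∈ T, p) n - ArithSeq.gam h (∏ p ∈ T, p) * Y| := by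
  have hL0 : 0 < L := by linarith
  have hl0 : 0 < Real.log L := Real.log_pos hL
  have hkR : (1 : ℝ) ≤ k := by exact_mod_cast hk
  have hYR : (0 : ℝ) < Y := by exact_mod_cast hY
  have hz0 : 0 < L ^ η := Real.rpow_pos_of_pos hL0 _
  have hQ : ∀ p ∈ middlePrimes L η, p.Prime ∧ L ^ η < p ∧ (p : ℝ) ≤ L ^ (1 - η) := fun p hp =>
    (mem_middlePrimes hL0.le).1 hp
  set w : ℕ → ℝ := fun p => (1 - h p) / (p : ℝ) with hwdef
  have hw0 : ∀ p, 0 ≤ w p := fun p => div_nonneg (by linarith [(hh p).2]) (Nat.cast_nonneg _)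
  have htotal : 9 / 10 * η ≤ ∑ p ∈ middlePrimes L η, w p := by
    have h1 : ∑ p ∈ middlePrimes L η, (1 - h p) / (p : ℝ) * Real.log p ≤
        (∑ p ∈ middlePrimes L η, w p) * Real.log L := by
      rw [Finset.sum_mul]
      refine Finset.sum_le_sum fun p hp => mul_le_mul_of_nonneg_left ?_ (hw0 p)
      have hp0 : (0 : ℝ) < p := by exact_mod_cast (hQ p hp).1.pos
      have h2 := Real.log_le_log hp0 (hQ p hp).2.2
      rw [Real.log_rpow hL0] at h2
      nlinarith
    by_contra! hc
    nlinarith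
  -- Extracting k blocks of weight m needs total weight 2km = 4η/5, below the 9η/10 available.
  set m := 2 * η / (5 * k) with hm
  have hm0 : 0 < m := by positivity
  have hwm : ∀ p ∈ middlePrimes L η, w p ≤ m := fun p hp => by
    have hp0 : (0 : ℝ) < p := by exact_mod_cast (hQ p hp).1.pos
    rw [hwdef, hm, div_le_div_iff₀ hp0 (by positivity)]
    have h3 := (hQ p hp).2.1.le
    calc (1 - h p) * (5 * k) ≤ 1 * (5 * k) := by gcongr; linarith [(hh p).1]
      _ ≤ 2 * η * L ^ η := by linarith
      _ ≤ _ := by gcongr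
  obtain ⟨B, hB, hd, hs⟩ := exists_disjoint_blocks hm0.le k (middlePrimes L η) hwm (by
    have : 2 * (k : ℝ) * m = 4 / 5 * η := by rw [hm]; field_simp; norm_num
    rw [this]
    linarith)
  have hBp : ∀ j, ∀ p ∈ B j, p.Prime := fun j p hp => (hQ p (hB j hp)).1
  set F : ℕ → ℕ → ℝ := fun j n =>
    ∏ p ∈ B j, if p ∣ n then h p * (1 - 1 / (p : ℝ)) * (1 - h p / p)⁻¹ else 1 with hF
  set γ : ℕ → ℝ := fun j => ∏ p ∈ B j, ((p : ℝ) - 1) / ((p : ℝ) - h p) with hγ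
  -- Otherwise n would have a prime factor above L^η in each of the k blocks, so n > (L^η)^k ≥ Y.
  have hF1 : ∀ n ∈ Finset.Icc 1 Y, ∃ j ∈ Finset.range k, F j n = 1 := by
    intro n hn
    obtain ⟨hn1, hn2⟩ := Finset.mem_Icc.1 hn
    by_contra! hc
    have hex : ∀ j < k, ∃ p ∈ B j, p ∣ n := by
      intro j hj
      by_contra! hnd
      exact hc j (Finset.mem_range.2 hj) (Finset.prod_eq_one fun p hp => if_neg (hnd p hp))
    have h1 := pow_lt_of_forall_exists_dvd hz0.le hk.ne' (by omega)
      (fun j p hp => ⟨hBp j p hp, (hQ p (hB j hp)).2.1⟩) hd hex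
    have h2 : (n : ℝ) ≤ Y := by exact_mod_cast hn2
    linarith
  by_contra! hc
  have hdisj : ∀ J : Finset ℕ, (J : Set ℕ).PairwiseDisjoint B := fun J i _ j _ hij => hd hij
  have key := mul_prod_one_sub_le (F := F) (γ := γ) (k := k) (δ := δ * Y) hF1 (by
    intro J _
    have hsub : J.biUnion B ⊆ middlePrimes L η := Finset.biUnion_subset.2 fun j _ => hB j
    have hT : ∀ p ∈ J.biUnion B, p.Prime := fun p hp => (hQ p (hsub hp)).1
    have h1 := hc _ hsub
    simp_rw [ArithSeq.f_prod hT, ArithSeq.gam_prod hT] at h1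
    rw [Finset.prod_biUnion (hdisj J)] at h1
    simp_rw [Finset.prod_biUnion (hdisj J)] at h1
    exact h1)
  rw [← mul_assoc] at key
  have key' := le_of_mul_le_mul_right key hYR
  -- Each factor is 1 - γ_j ≥ 1 - exp(-m) ≥ m/2.
  have hlow : (m / 2) ^ k ≤ ∏ j ∈ Finset.range k, (1 - γ j) := by
    calc (m / 2) ^ k = ∏ j ∈ Finset.range k, (m / 2) := by rw [Finset.prod_const, Finset.card_range]
      _ ≤ _ := by
        refine Finset.prod_le_prod (fun _ _ => by positivity) fun j hj => ?_
        have h1 := (ArithSeq.prod_gam_factor_le hh (hBp j)).2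
        have h2 := hs j (Finset.mem_range.1 hj)
        have h3 : Real.exp (-∑ p ∈ B j, (1 - h p) / (p : ℝ)) ≤ Real.exp (-m) :=
          Real.exp_le_exp.2 (neg_le_neg h2)
        have h4 : Real.exp (-m) ≤ 1 / (1 + m) := by
          rw [Real.exp_neg, one_div]
          gcongr
          linarith [Real.add_one_le_exp m]
        have hm1 : m ≤ 1 := by
          rw [hm, div_le_one (by positivity)]
          linarith
        have h5 : 1 / (1 + m) ≤ 1 - m / 2 := by
          rw [div_le_iff₀ (by positivity)]
          nlinarith
        simp only [hγ]
        linarith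
  -- Since m/2 = 2 · η/(10k), the spare 2 per block cancels the number 2^k of subsets.
  have hfin : (m / 2) ^ k = 2 ^ k * (η / (10 * k)) ^ k := by
    rw [← mul_pow, hm]
    congr 1
    field_simp
    norm_num
  have : 2 ^ k * δ < 2 ^ k * (η / (10 * k)) ^ k := by gcongr
  linarith

/-! ### Proof of the corollary -/

set_option maxHeartbeats 1000000 in
theorem corollary1p4 :
    ∃ c : ℝ, 0 < c ∧ ∃ x₀ : ℝ, ∀ x : ℝ, x₀ ≤ x →
      ∀ (a : ℕ → ℝ) (S : Finset ℕ) (h : ArithmeticFunction ℝ) (α η u : ℝ),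
        (∀ n, 0 ≤ a n) →
        (∀ p ∈ S, p.Prime ∧ (p : ℝ) ≤ Real.log (Real.log x)) →
        h.IsMultiplicative →
        (∀ n, 0 ≤ h n ∧ h n ≤ 1) →
        60 * Real.log (Real.log (Real.log x)) / Real.log (Real.log x) ≤ α →
        α * Real.log (Real.log x) ≤
          ∑ p ∈ Finset.Icc 1 ⌊Real.log x⌋₊ with p.Prime,
            (1 - h p) / (p : ℝ) * Real.log p →
        η = min (α / 3) (1 / 100) →
        5 / η ^ 2 ≤ u →
        u ≤ η * Real.log x ^ (η / 2) →
        (∃ v y : ℝ, Set.Ioo v (v + y) ⊆ Set.Ioo (x / 4) x ∧ Real.log x ^ u ≤ y ∧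
          c * (Real.exp (-(u / η) * (1 + 25 * η) * Real.log (2 * u / η ^ 3)) *
              (y * (ArithSeq.sum a x / x))) ≤
            |ArithSeq.sum a (v + y) - ArithSeq.sum a v - y * (ArithSeq.sum a x / x)|) ∨
        (∃ (y : ℝ) (q b : ℕ), y ∈ Set.Ioo (x / 4) x ∧ 1 ≤ q ∧ ArithSeq.CoprimeTo q S ∧
          (q : ℝ) ≤ Real.exp (2 * Real.log x ^ (1 - η)) ∧
          c * (Real.exp (-(u / η) * (1 + 25 * η) * Real.log (2 * u / η ^ 3)) *
              (ArithSeq.sum a x / (Nat.totient q : ℝ))) ≤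
            |ArithSeq.sumAP a y q b -
              ArithSeq.f h q b / (q * ArithSeq.gam h q) * (y * (ArithSeq.sum a x / x))|) := by
  obtain ⟨K, hK⟩ := exists_le_sum_middlePrimes
  obtain ⟨ℓ₀, hℓ₀6, hℓ₀⟩ := exists_threshold K
  -- The constant absorbs 1 + 16 q/φ(q) ≤ 17 exp(4/η); the threshold gives log log x ≥ ℓ₀.
  refine ⟨1 / 17, by norm_num, Real.exp (Real.exp ℓ₀), ?_⟩
  intro x hx a S h α η u _ hS _ hh hα hsum hη hu hu2
  have hx0 : 0 < x := (Real.exp_pos _).trans_le hx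
  set L := Real.log x with hLdef
  have hLexp : Real.exp ℓ₀ ≤ L := (Real.le_log_iff_exp_le hx0).2 hx
  have hL0 : 0 < L := (Real.exp_pos _).trans_le hLexp
  set ℓ := Real.log L with hℓdef
  have hℓ : ℓ₀ ≤ ℓ := (Real.le_log_iff_exp_le hL0).2 hLexp
  obtain ⟨hlog1, hlogK, hlogℓ⟩ := hℓ₀ ℓ hℓ
  have hℓ0 : 0 < ℓ := by linarith
  have hL100 : 100 ≤ L := by
    have h1 : Real.exp 6 ≤ L := (Real.exp_le_exp.2 (hℓ₀6.trans hℓ)).trans_eq (Real.exp_log hL0)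
    have h2 : Real.exp 6 = Real.exp 1 ^ 6 := by rw [← Real.exp_nat_mul]; norm_num
    have h3 : (2.7 : ℝ) ^ 6 ≤ Real.exp 1 ^ 6 := by
      gcongr
      linarith [Real.exp_one_gt_d9]
    norm_num at h3
    linarith
  have hL1 : 1 < L := by linarith
  have hη3 : 3 * η ≤ α := by
    have := min_le_left (α / 3) (1 / 100)
    linarith
  have hη1 : η ≤ 1 / 100 := hη ▸ min_le_right _ _
  -- If η = α/3 this is the lower bound on α, with 60 = 3 · 20; if η = 1/100 it comes from x being
  -- large.
  have hηℓ : 20 * Real.log ℓ ≤ η * ℓ := by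
    rw [div_le_iff₀ hℓ0] at hα
    rcases min_choice (α / 3) (1 / 100) with h1 | h1 <;> rw [h1] at hη <;> rw [hη] <;> linarith
  have hη0 : 0 < η := by
    by_contra! hc
    nlinarith
  have hmass : 9 / 10 * (η * ℓ) ≤
      ∑ p ∈ middlePrimes L η, (1 - h p) / (p : ℝ) * Real.log p := by
    have := hK L η α h hL1 hη0 (by linarith) hη3 hh hsum
    linarith
  have hhalf : 5 / η ≤ L ^ (η / 2) := by
    have h1 : ℓ ≤ L ^ (η / 2) := by
      rw [Real.rpow_def_of_pos hL0]
      conv_lhs => rw [← Real.exp_log hℓ0]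
      refine Real.exp_le_exp.2 ?_
      linarith
    refine le_trans ?_ h1
    rw [div_le_iff₀ hη0]
    linarith
  have hhalf0 : 0 < L ^ (η / 2) := Real.rpow_pos_of_pos hL0 _
  have hsq : L ^ η = L ^ (η / 2) * L ^ (η / 2) := by
    rw [← Real.rpow_add hL0, add_halves]
  have hηi : 500 ≤ 5 / η := by
    rw [le_div_iff₀ hη0]; linarith
  have hLη : 4 ≤ L ^ η := by nlinarith
  have huη : 2 ≤ u / η := by
    have h1 : 5 / η ^ 2 / η ≤ u / η := by gcongr
    refine le_trans ?_ h1
    rw [div_div, le_div_iff₀ (by positivity)]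
    have : η ^ 2 * η ≤ 1 := by
      have := pow_le_one₀ (n := 3) hη0.le (by linarith)
      linarith [show η ^ 2 * η = η ^ 3 by ring]
    linarith
  have huη2 : u / η ≤ L ^ (η / 2) := by
    rw [div_le_iff₀ hη0]; linarith
  have hu0 : 0 < u := by
    rw [le_div_iff₀ hη0] at huη
    linarith
  -- The extra 1 gives a spare factor L^η ≥ 2, needed because rounding L^u up to Y may nearly double
  -- it.
  set k := ⌈u / η⌉₊ + 1 with hk
  have hku : (k : ℝ) ≤ u / η + 2 := by
    have := (Nat.ceil_lt_add_one (show 0 ≤ u / η by linarith)).le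
    rw [hk]; push_cast; linarith
  have hkl : u / η + 1 ≤ k := by
    have := Nat.le_ceil (u / η)
    rw [hk]; push_cast; linarith
  set Y := ⌈L ^ u⌉₊ with hYdef
  have hLu : 1 ≤ L ^ u := Real.one_le_rpow hL1.le hu0.le
  have hYl : L ^ u ≤ Y := Nat.le_ceil _
  have hYu : (Y : ℝ) ≤ 2 * L ^ u := by
    have := (Nat.ceil_lt_add_one (show 0 ≤ L ^ u by linarith)).le
    linarith
  have hY0 : 0 < Y := by
    have : (0 : ℝ) < Y := by linarith
    exact_mod_cast this
  have hYk : (Y : ℝ) ≤ (L ^ η) ^ k := by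
    rw [← Real.rpow_mul_natCast hL0.le]
    calc (Y : ℝ) ≤ L ^ u * L ^ η := by nlinarith
      _ = L ^ (u + η) := (Real.rpow_add hL0 _ _).symm
      _ ≤ _ := by
        refine Real.rpow_le_rpow_of_exponent_le hL1.le ?_
        calc u + η = η * (u / η + 1) := by rw [mul_add, mul_div_cancel₀ _ hη0.ne', mul_one]
          _ ≤ _ := by gcongr
  have hw : 5 * k ≤ 2 * η * L ^ η := by
    have h1 : (k : ℝ) ≤ 2 * L ^ (η / 2) := by linarith
    have h2 : 5 ≤ η * L ^ (η / 2) := by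
      rw [div_le_iff₀ hη0] at hhalf
      linarith
    rw [hsq]
    nlinarith
  set E := Real.exp (-(u / η) * (1 + 25 * η) * Real.log (2 * u / η ^ 3)) with hE
  have hE0 : 0 < E := Real.exp_pos _
  obtain ⟨T, hT, hTlt⟩ := exists_subset_lt_abs_sum_f_sub h hh hL1 hη0 (by linarith)
    (Nat.succ_pos _) hY0 hw hYk hmass (exp_mul_exp_lt_pow hη0 hη1 hu (Nat.succ_pos _) hku)
  have hQ : ∀ p ∈ T, p.Prime ∧ L ^ η < p ∧ (p : ℝ) ≤ L ^ (1 - η) := fun p hp =>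
    (mem_middlePrimes hL0.le).1 (hT hp)
  have hTp : ∀ p ∈ T, p.Prime := fun p hp => (hQ p hp).1
  set q := ∏ p ∈ T, p with hq
  have hq0 : 0 < q := Finset.prod_pos fun p hp => (hTp p hp).pos
  have hqexp : (q : ℝ) ≤ Real.exp (2 * L ^ (1 - η)) :=
    prod_primes_le_exp (Real.rpow_nonneg hL0.le _) fun p hp => ⟨hTp p hp, (hQ p hp).2.2⟩
  have hexp32 : 32 * Real.exp (L / 2) ≤ x := by
    have h1 : 32 ≤ Real.exp (L / 2) := by
      have := Real.add_one_le_exp (L / 2)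
      linarith
    calc 32 * Real.exp (L / 2) ≤ Real.exp (L / 2) * Real.exp (L / 2) := by gcongr
      _ = x := by rw [← Real.exp_add, add_halves, Real.exp_log hx0]
  have hqx : 16 * (q : ℝ) ≤ x := by
    have h1 : L ^ (1 - η) ≤ L / 4 := by
      rw [Real.rpow_sub hL0, Real.rpow_one]
      gcongr
    have h2 : Real.exp (2 * L ^ (1 - η)) ≤ Real.exp (L / 2) := Real.exp_le_exp.2 (by linarith)
    linarith [Real.exp_pos (L / 2)]
  have hYx : 16 * (Y : ℝ) ≤ x := by
    have h1 : L ^ u ≤ Real.exp (L / 2) := by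
      rw [Real.rpow_def_of_pos hL0]
      refine Real.exp_le_exp.2 ?_
      have h2 : ℓ ≤ 2 * L ^ (1 / 2 : ℝ) := by
        have := Real.log_le_rpow_div hL0.le (ε := 1 / 2) (by norm_num)
        linarith
      have h3 : u ≤ 1 / 100 * L ^ (1 / 2 : ℝ) := hu2.trans (by
        gcongr
        · exact hL1.le
        · linarith)
      have h4 : L ^ (1 / 2 : ℝ) * L ^ (1 / 2 : ℝ) = L := by
        rw [← Real.rpow_add hL0]; norm_num
      calc ℓ * u ≤ (2 * L ^ (1 / 2 : ℝ)) * (1 / 100 * L ^ (1 / 2 : ℝ)) := by gcongr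
        _ = L / 50 := by linear_combination (1 / 50) * h4
        _ ≤ L / 2 := by linarith
    linarith
  have hqS : ArithSeq.CoprimeTo q S := by
    intro r hr
    refine Nat.Coprime.prod_left fun p hp => (Nat.coprime_primes (hTp p hp) (hS r hr).1).2 ?_
    rintro rfl
    -- Primes of S are at most log log x, below every prime used in q.
    have h1 : ℓ ≤ L ^ η := by
      rw [Real.rpow_def_of_pos hL0]
      conv_lhs => rw [← Real.exp_log hℓ0]
      exact Real.exp_le_exp.2 (by linarith)
    linarith [(hQ p hp).2.1, (hS p hr).2]
  by_contra! hcon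
  obtain ⟨hrow, hcol⟩ := hcon
  -- Failure of (ii) for q = 1 bounds an absolute value strictly by a positive multiple of A(x), so
  -- A(x) > 0.
  have hA : 0 < ArithSeq.sum a x := by
    have h1 := (abs_nonneg _).trans_lt (hcol (x / 2) 1 0 ⟨by linarith, by linarith⟩ le_rfl
      (fun p _ => Nat.coprime_one_left p)
      (by simpa using (show 0 ≤ L ^ (1 - η) from Real.rpow_nonneg hL0.le _)))
    rw [Nat.totient_one, Nat.cast_one, div_one] at h1
    by_contra! hc
    nlinarith
  have hγ := ArithSeq.prod_gam_factor_le hh hTp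
  rw [← ArithSeq.gam_prod hTp, ← hq] at hγ
  have hγ1 : ArithSeq.gam h q ≤ 1 := hγ.2.trans (Real.exp_le_one_iff.2 (neg_nonpos.2
    (Finset.sum_nonneg fun p _ => div_nonneg (by linarith [(hh p).2]) (Nat.cast_nonneg _))))
  have hmaier := ArithSeq.abs_sum_sub_le_of_maier (a := a) (F := ArithSeq.f h q) (ε := 1 / 17 * E)
    hx0 hA hq0 hγ.1 (by positivity) hqx hYx
    (fun m h1 h2 => by
      have := hrow m Y (Set.Ioo_subset_Ioo h1 h2) hYl
      linarith)
    (fun n b h1 h2 => by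
      have := hcol n q b ⟨h1, h2⟩ hq0 hqS hqexp
      linarith)
  have hD : (q : ℝ) / Nat.totient q ≤ Real.exp (4 / η) := by
    refine (prod_div_totient_le hTp).trans (Real.exp_le_exp.2 ?_)
    have h1 : Real.log 4 ≤ Real.log L := Real.log_le_log (by norm_num) (by linarith)
    have h2 := sum_one_div_middlePrimes_le hL1 hη0 h1 (by linarith)
    have h3 : ∑ p ∈ T, 1 / (p : ℝ) ≤ ∑ p ∈ middlePrimes L η, 1 / (p : ℝ) :=
      Finset.sum_le_sum_of_subset_of_nonneg hT fun p _ _ => by positivity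
    calc 2 * ∑ p ∈ T, 1 / (p : ℝ) ≤ 2 * (2 / η) := by gcongr; exact h3.trans h2
      _ = 4 / η := by ring
  have hD1 : 1 ≤ Real.exp (4 / η) := Real.one_le_exp (by positivity)
  have hfinal : ArithSeq.gam h q * (1 / 17 * E * (1 + 16 * ((q : ℝ) / Nat.totient q)) * Y) ≤
      E * Real.exp (4 / η) * Y := by
    calc _ ≤ 1 * (1 / 17 * E * (Real.exp (4 / η) + 16 * Real.exp (4 / η)) * Y) := by gcongr
      _ = _ := by ring
  linarith
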